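/- Let $\mathcal H$ be a complex Hilbert space with $\dim\mathcal H\ge 3$. For a bounded linear operator $T$ on a Hilbert space put $W(T)=\{\langle Tx,x\rangle:\|x\|=1\}$ and $w(T)=\sup\{|\mu|:\mu\in W(T)\}$. Let $\alpha\in(0,\pi/2)$, $$S(\alpha)=\{a+ib: a,b\in\mathbb R,\ |b|\le a\tan\alpha\},\qquad \tau(\alpha)=\sup\{\|T\|/w(T): T\in\mathcal B(\mathcal H),\ T\ne 0,\ W(T)\subseteq S(\alpha)\}.$$ Put $s=\sin^2\alpha$ and $c=s/\sqrt{1+2s}$, let $\theta\in[0,\alpha]$ be the angle with $\sin^2\theta=\frac{s+s^2}{1+2s}$ (equivalently $\cos^2\theta=\frac{1+s-s^2}{1+2s}$), and let $$B=\begin{pmatrix}\cos\theta+c&\sin\alpha\\-\sin\alpha&\cos\theta-c\end{pmatrix}.$$ Let $T\in\mathcal B(\mathcal H)$ be nonzero and let $x\in\mathcal H$ be a unit vector with $\|Tx\|=\|T\|$. Put $V=\operatorname{span}\{x,Tx\}$. Then $W(T)\subseteq S(\alpha)$ and $\|T\|/w(T)=\tau(\alpha)$ if and only if the operator matrix of $T/\|T\|$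 on $V\oplus V^\perp$ has the form $T_1\oplus T_2$, where $T_1$ is unitarily similar to $B/\|B\|$ ($\|B\|$ being the operator norm), $W(T_2)\subseteq S(\alpha)$ and $w(T_2)\le 1/\tau(\alpha)$. -/

import Mathlib

noncomputable section

/-- The numerical range `W(T) = {⟨Tx, x⟩ : ‖x‖ = 1}`.  Mathlib's inner product is conjugate-linear
in its first argument, so `⟨Tx, x⟩` (linear in `Tx`) is written `inner ℂ x (T x)`. -/
def numRange {E : Type*} [NormedAddCommGroup E] [InnerProductSpace ℂ E] (T : E →L[ℂ] E) : Set ℂ :=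
  {z | ∃ x : E, ‖x‖ = 1 ∧ z = inner ℂ x (T x)}

/-- The numerical radius `w(T) = sup {|z| : z ∈ W(T)}`
(the set is bounded by `‖T‖`, and non-empty as soon as `E` is nonzero). -/
def numRadius {E : Type*} [NormedAddCommGroup E] [InnerProductSpace ℂ E] (T : E →L[ℂ] E) : ℝ :=
  sSup {r | ∃ z ∈ numRange T, r = ‖z‖}

/-- The sector `S(α) = {a + ib : |b| ≤ a tan α}`, used for `0 ≤ α < π/2`. -/
def sector (α : ℝ) : Set ℂ :=
  {z | |z.im| ≤ z.re * Real.tan α}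

/-- `τ(α) = sup {‖T‖ / w(T) : T ≠ 0, W(T) ⊆ S(α)}`, over bounded operators on the Hilbert space
`H`. -/
def tauConst (H : Type*) [NormedAddCommGroup H] [InnerProductSpace ℂ H] (α : ℝ) : ℝ :=
  sSup {r | ∃ T : H →L[ℂ] H, T ≠ 0 ∧ numRange T ⊆ sector α ∧ r = ‖T‖ / numRadius T}

/-- `s = sin² α`. -/
def sPar (α : ℝ) : ℝ := Real.sin α ^ 2

/-- `c = s / √(1 + 2s)`. -/
def cPar (α : ℝ) : ℝ := sPar α / Real.sqrt (1 + 2 * sPar α)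

/-- The angle `θ ∈ [0, π/2]` with `sin² θ = (s + s²) / (1 + 2s)`; see `sin_thetaPar_sq`,
`cos_thetaPar_sq`, `thetaPar_nonneg` and `thetaPar_le` below. -/
def thetaPar (α : ℝ) : ℝ := Real.arcsin (Real.sqrt ((sPar α + sPar α ^ 2) / (1 + 2 * sPar α)))

/-- The matrix `B` with rows `(cos θ + c, sin α)` and `(-sin α, cos θ - c)`, as an operator on
Euclidean `ℂ²`, so that `‖opB α‖` is the operator norm. -/
def opB (α : ℝ) : EuclideanSpace ℂ (Fin 2) →L[ℂ] EuclideanSpace ℂ (Fin 2) :=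
  Matrix.toEuclideanCLM (𝕜 := ℂ) (n := Fin 2)
    !![((Real.cos (thetaPar α) + cPar α : ℝ) : ℂ), ((Real.sin α : ℝ) : ℂ);
       ((-Real.sin α : ℝ) : ℂ), ((Real.cos (thetaPar α) - cPar α : ℝ) : ℂ)]

/-- `T / ‖T‖`. -/
def normalized {E : Type*} [NormedAddCommGroup E] [InnerProductSpace ℂ E] (T : E →L[ℂ] E) :
    E →L[ℂ] E :=
  ((‖T‖⁻¹ : ℝ) : ℂ) • T

/-- Unitary similarity of operators on two (possibly different) inner product spaces:
`U A = A' U` for some surjective linear isometry `U`. -/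
def UnitarilySimilar {E F : Type*} [NormedAddCommGroup E] [InnerProductSpace ℂ E]
    [NormedAddCommGroup F] [InnerProductSpace ℂ F] (A : E →L[ℂ] E) (A' : F →L[ℂ] F) : Prop :=
  ∃ U : E ≃ₗᵢ[ℂ] F, ∀ v : E, U (A v) = A' (U v)

/-- The operator matrix of `T` on `V ⊕ Vᗮ` is `T₁ ⊕ T₂`. -/
def HasDirectSumForm {E : Type*} [NormedAddCommGroup E] [InnerProductSpace ℂ E] (T : E →L[ℂ] E)
    (V : Submodule ℂ E) (T₁ : V →L[ℂ] V) (T₂ : Vᗮ →L[ℂ] Vᗮ) : Prop :=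
  ∀ (v : V) (w : Vᗮ), T ((v : E) + (w : E)) = (T₁ v : E) + (T₂ w : E)

theorem sPar_nonneg (α : ℝ) : 0 ≤ sPar α := sq_nonneg _

theorem sPar_le_one (α : ℝ) : sPar α ≤ 1 := Real.sin_sq_le_one α

theorem sin_thetaPar (α : ℝ) :
    Real.sin (thetaPar α) = Real.sqrt ((sPar α + sPar α ^ 2) / (1 + 2 * sPar α)) := by
  have h0 := sPar_nonneg α
  have h1 := sPar_le_one α
  apply Real.sin_arcsin
  · linarith [Real.sqrt_nonneg ((sPar α + sPar α ^ 2) / (1 + 2 * sPar α))]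
  · rw [Real.sqrt_le_one, div_le_one (by linarith)]
    nlinarith

theorem sin_thetaPar_sq (α : ℝ) :
    Real.sin (thetaPar α) ^ 2 = (sPar α + sPar α ^ 2) / (1 + 2 * sPar α) := by
  have h0 := sPar_nonneg α
  rw [sin_thetaPar, Real.sq_sqrt (by positivity)]

theorem cos_thetaPar_sq (α : ℝ) :
    Real.cos (thetaPar α) ^ 2 = (1 + sPar α - sPar α ^ 2) / (1 + 2 * sPar α) := by
  have h0 := sPar_nonneg α
  have h2 : (1 + 2 * sPar α) ≠ 0 := by positivity
  rw [Real.cos_sq', sin_thetaPar_sq]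
  field_simp
  ring

theorem thetaPar_nonneg (α : ℝ) : 0 ≤ thetaPar α :=
  Real.arcsin_nonneg.2 (Real.sqrt_nonneg _)

theorem thetaPar_le (α : ℝ) (h0 : 0 ≤ α) (h1 : α < Real.pi / 2) : thetaPar α ≤ α := by
  have hs := sPar_nonneg α
  have hsin : 0 ≤ Real.sin α := Real.sin_nonneg_of_nonneg_of_le_pi h0 (by linarith [Real.pi_pos])
  rw [thetaPar, Real.arcsin_le_iff_le_sin' ⟨by linarith [Real.pi_pos], h1⟩]
  rw [Real.sqrt_le_left hsin, div_le_iff₀ (by positivity)]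
  change _ ≤ sPar α * _
  nlinarith

end

/-! Scale to `N = T/‖T‖` and put `y = N x`. Since `N` attains its norm `1` at `x`, `N*N x = x`, so
for `|ζ| = 1` the quadratic form of `N` at `x + ζy` is `2p + ζ̄ + ζq` with `p = ⟨Nx, x⟩`, `q = ⟨N²x,
x⟩`. The sector condition over this circle and the radius bound at `ζ = ±i` give two quadratic
inequalities in `p` and `q` (`core_inequality`). Eliminating `Re p` leaves a sum of squares bounded
by a positive multiple of `(1 + s)w² - 1` (`core_algebra`). Hence `w² ≥ 1/(1 + s)`, and equality
determines `p` and `q` (`gram_of_core_eq`).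

Compressing to a two-vector span extends the bound to operators that need not attain their norm, and
`B` shows that it is sharp, so `τ(α) = √(1 + s)` (`tauConst_eq`).

In the equality case `|⟨Nv, v⟩| = w‖v‖²` at `v = x ± iy`, and the first-order conditions there force
`V` to reduce `N` (`inner_eq_zero_of_core_eq`). On `V` the operator is determined up to unitary
similarity by `p` and `q`; as `B/‖B‖` is itself an equality case, it has the same `p` and `q`
(`unitarilySimilar_normalized_opB`). Conversely, the form of a direct sum is the sum of the forms,
the sector is a convex cone, and the radius bounds add up. -/

open scoped ComplexConjugate

/-! ### Quadratic forms, numerical range and numerical radius -/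

section Forms

variable {E : Type*} [NormedAddCommGroup E] [InnerProductSpace ℂ E]

theorem numRadius_nonneg (T : E →L[ℂ] E) : 0 ≤ numRadius T := by
  apply Real.sSup_nonneg
  rintro r ⟨z, -, rfl⟩
  exact norm_nonneg z

theorem inner_smul_apply_smul (T : E →L[ℂ] E) (a : ℂ) (v : E) :
    inner ℂ (a • v) (T (a • v)) = ((‖a‖ ^ 2 : ℝ) : ℂ) * inner ℂ v (T v) := by
  rw [map_smul, inner_smul_left, inner_smul_right, ← mul_assoc, Complex.conj_mul']
  push_cast
  rfl

theorem inner_normalize_apply_normalize (T : E →L[ℂ] E) {v : E} (hv : v ≠ 0) :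
    ‖((‖v‖⁻¹ : ℝ) : ℂ) • v‖ = 1 ∧
    inner ℂ v (T v) = ((‖v‖ ^ 2 : ℝ) : ℂ) *
      inner ℂ (((‖v‖⁻¹ : ℝ) : ℂ) • v) (T (((‖v‖⁻¹ : ℝ) : ℂ) • v)) := by
  have hn : ‖v‖ ≠ 0 := norm_ne_zero_iff.2 hv
  constructor
  · rw [norm_smul, Complex.norm_real, norm_inv, norm_norm, inv_mul_cancel₀ hn]
  · rw [inner_smul_apply_smul, Complex.norm_real, norm_inv, norm_norm, ← mul_assoc,
      ← Complex.ofReal_mul, ← mul_pow, mul_inv_cancel₀ hn]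
    simp

theorem norm_inner_le_numRadius (T : E →L[ℂ] E) (v : E) :
    ‖inner ℂ v (T v)‖ ≤ numRadius T * ‖v‖ ^ 2 := by
  by_cases hv : v = 0
  · simp [hv]
  obtain ⟨h1, h2⟩ := inner_normalize_apply_normalize T hv
  rw [h2, norm_mul, Complex.norm_real, norm_pow, norm_norm, mul_comm]
  gcongr
  apply le_csSup
  · refine ⟨‖T‖, ?_⟩
    rintro r ⟨z, ⟨u, hu, rfl⟩, rfl⟩
    calc ‖inner ℂ u (T u)‖ ≤ ‖u‖ * ‖T u‖ := norm_inner_le_norm _ _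
      _ ≤ ‖u‖ * (‖T‖ * ‖u‖) := by gcongr; exact T.le_opNorm u
      _ = ‖T‖ := by simp [hu]
  · exact ⟨_, ⟨_, h1, rfl⟩, rfl⟩

theorem numRadius_le {T : E →L[ℂ] E} {w : ℝ} (hw : 0 ≤ w)
    (h : ∀ v, ‖inner ℂ v (T v)‖ ≤ w * ‖v‖ ^ 2) : numRadius T ≤ w := by
  refine Real.sSup_le ?_ hw
  rintro r ⟨z, ⟨u, hu, rfl⟩, rfl⟩
  simpa [hu] using h u

theorem numRange_subset_sector_iff {T : E →L[ℂ] E} {α : ℝ} :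
    numRange T ⊆ sector α ↔
      ∀ v, |(inner ℂ v (T v)).im| ≤ (inner ℂ v (T v)).re * Real.tan α := by
  constructor
  · intro h v
    by_cases hv : v = 0
    · simp [hv]
    obtain ⟨h1, h2⟩ := inner_normalize_apply_normalize T hv
    have h3 : |(inner ℂ (((‖v‖⁻¹ : ℝ) : ℂ) • v) (T (((‖v‖⁻¹ : ℝ) : ℂ) • v))).im| ≤ _ :=
      h ⟨_, h1, rfl⟩
    rw [h2, Complex.im_ofReal_mul, Complex.re_ofReal_mul, abs_mul, abs_of_nonneg (by positivity),
      mul_assoc]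
    gcongr
  · rintro h z ⟨u, -, rfl⟩
    exact h u

end Forms

/-- Choosing `ζ` with `ζh = -‖h‖` turns a family of affine inequalities over the unit circle into a
single modulus bound. -/
theorem norm_le_of_forall_unit {a : ℝ} {h : ℂ}
    (H : ∀ ζ : ℂ, ‖ζ‖ = 1 → 0 ≤ a + (ζ * h).re) : ‖h‖ ≤ a := by
  by_cases hh : h = 0
  · have h1 := H 1 (by simp)
    simpa [hh] using h1
  have hn : ‖h‖ ≠ 0 := norm_ne_zero_iff.2 hh
  have h1 := H (-(conj h / (‖h‖ : ℂ))) (by simp [hn])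
  have h2 : -(conj h / (‖h‖ : ℂ)) * h = ((-‖h‖ : ℝ) : ℂ) := by
    have : conj h * h = (‖h‖ : ℂ) ^ 2 := Complex.conj_mul' h
    have h3 : (‖h‖ : ℂ) ≠ 0 := by exact_mod_cast hn
    push_cast
    field_simp
    rw [this]
  rw [h2, Complex.ofReal_re] at h1
  linarith

/-- The discriminant of this quadratic is `β²`. Both first-order conditions below rest on this. -/
theorem eq_zero_of_forall_nonneg_add_sq {β γ : ℝ} (h : ∀ t : ℝ, 0 ≤ t * β + t ^ 2 * γ) :
    β = 0 := by
  have h1 : discrim γ β 0 ≤ 0 := discrim_le_zero fun t => by linarith [h t, sq t]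
  rw [discrim] at h1
  nlinarith [sq_nonneg β]

/-! ### The core inequality and its equality case -/

section Core

variable {E : Type*} [NormedAddCommGroup E] [InnerProductSpace ℂ E]

/-- The first-order condition at a vector where `T` attains its norm. -/
theorem inner_apply_apply_of_norm_attained {T : E →L[ℂ] E} {x : E} (hx : ‖x‖ = 1)
    (hTx : ‖T x‖ = ‖T‖) (z : E) :
    inner ℂ (T x) (T z) = ((‖T‖ ^ 2 : ℝ) : ℂ) * inner ℂ x z := by
  have key : ∀ z : E, (inner ℂ (T x) (T z)).re = ‖T‖ ^ 2 * (inner ℂ x z).re := by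
    intro z
    have h : ∀ t : ℝ, 0 ≤ t * (2 * (‖T‖ ^ 2 * (inner ℂ x z).re - (inner ℂ (T x) (T z)).re))
        + t ^ 2 * (‖T‖ ^ 2 * ‖z‖ ^ 2 - ‖T z‖ ^ 2) := by
      intro t
      have h1 := T.le_opNorm (x + (t : ℂ) • z)
      have h2 : ‖T (x + (t : ℂ) • z)‖ ^ 2 ≤ ‖T‖ ^ 2 * ‖x + (t : ℂ) • z‖ ^ 2 := by
        rw [← mul_pow]
        gcongr
      rw [map_add, map_smul, norm_add_sq (𝕜 := ℂ), norm_add_sq (𝕜 := ℂ), inner_smul_right,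
        inner_smul_right, norm_smul, norm_smul, Complex.norm_real, hx, hTx, mul_pow, mul_pow,
        Real.norm_eq_abs, sq_abs] at h2
      simp only [RCLike.re_to_complex, Complex.re_ofReal_mul] at h2
      nlinarith
    have := eq_zero_of_forall_nonneg_add_sq h
    linarith
  apply Complex.ext
  · rw [key, Complex.re_ofReal_mul]
  -- Replacing `z` by `-iz` turns the identity of real parts into that of imaginary parts.
  · have h := key (-Complex.I • z)
    rw [map_smul, inner_smul_right, inner_smul_right] at h
    rw [Complex.im_ofReal_mul]
    simpa using h

/-- `hN` says `N*y = x`, so the diagonal term at `y` repeats `inner ℂ x y`; hence the factor 2. -/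
theorem inner_add_smul_apply {N : E →L[ℂ] E} {x y : E} (hy : ‖y‖ = 1)
    (hxy : N x = y) (hN : ∀ z, inner ℂ y (N z) = inner ℂ x z) {ζ : ℂ} (hζ : ‖ζ‖ = 1) :
    inner ℂ (x + ζ • y) (N (x + ζ • y)) =
      2 * inner ℂ x y + conj ζ + ζ * inner ℂ x (N y) := by
  have h1 : inner ℂ y y = (1 : ℂ) := by simp [inner_self_eq_norm_sq_to_K, hy]
  have h2 : conj ζ * ζ = 1 := by rw [Complex.conj_mul', hζ]; simp
  rw [map_add, map_smul, hxy]
  simp only [inner_add_left, inner_add_right, inner_smul_left, inner_smul_right, hN, h1]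
  linear_combination inner ℂ x y * h2

theorem norm_add_smul_sq_of_unit {x y : E} (hx : ‖x‖ = 1) (hy : ‖y‖ = 1) {ζ : ℂ} (hζ : ‖ζ‖ = 1) :
    ‖x + ζ • y‖ ^ 2 = 2 + 2 * (ζ * inner ℂ x y).re := by
  rw [norm_add_sq (𝕜 := ℂ), inner_smul_right, norm_smul, hx, hy, hζ]
  simp only [RCLike.re_to_complex]
  ring

/-- The inequality that carries both the value of `tauConst` and its equality case. -/
theorem core_inequality {N : E →L[ℂ] E} {x y : E} {α w : ℝ} (hα0 : 0 < α)
    (hα1 : α < Real.pi / 2) (hx : ‖x‖ = 1) (hy : ‖y‖ = 1)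
    (hxy : N x = y) (hN : ∀ z, inner ℂ y (N z) = inner ℂ x z)
    (hsec : ∀ v, |(inner ℂ v (N v)).im| ≤ (inner ℂ v (N v)).re * Real.tan α)
    (hw : ∀ v, ‖inner ℂ v (N v)‖ ≤ w * ‖v‖ ^ 2) :
    0 ≤ (inner ℂ x y).re ∧
    (1 - (inner ℂ x (N y)).re) ^ 2 + 4 * sPar α * (inner ℂ x (N y)).re ≤
      4 * sPar α * (inner ℂ x y).re ^ 2 ∧
    (inner ℂ x y).re ^ 2 + (inner ℂ x y).im ^ 2 +
      ((1 - (inner ℂ x (N y)).re) ^ 2 + (inner ℂ x (N y)).im ^ 2) / 4 ≤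
      w ^ 2 * (1 + (inner ℂ x y).im ^ 2) := by
  have hsin : 0 < Real.sin α := Real.sin_pos_of_pos_of_lt_pi hα0 (by linarith [Real.pi_pos])
  have hcos : 0 < Real.cos α := Real.cos_pos_of_mem_Ioo ⟨by linarith, hα1⟩
  set p : ℂ := inner ℂ x y
  set q : ℂ := inner ℂ x (N y)
  have hform : ∀ ζ : ℂ, ‖ζ‖ = 1 → inner ℂ (x + ζ • y) (N (x + ζ • y)) =
      2 * p + conj ζ + ζ * q := fun ζ hζ => inner_add_smul_apply hy hxy hN hζ
  have hnorm : ∀ ζ : ℂ, ‖ζ‖ = 1 → ‖x + ζ • y‖ ^ 2 = 2 + 2 * (ζ * p).re :=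
    fun ζ hζ => norm_add_smul_sq_of_unit hx hy hζ
  have hsec' : ∀ v, |(inner ℂ v (N v)).im| * Real.cos α ≤ (inner ℂ v (N v)).re * Real.sin α := by
    intro v
    have h := mul_le_mul_of_nonneg_right (hsec v) hcos.le
    rwa [mul_assoc, Real.tan_mul_cos hcos.ne'] at h
  -- Adding one sector inequality at `ζ` and the opposite one at `conj ζ` cancels the imaginary
  -- parts of `p` and `q`. What remains is affine in `ζ`.
  have hh : ‖(⟨Real.sin α * (1 + q.re), -(Real.cos α * (1 - q.re))⟩ : ℂ)‖ ≤
      2 * p.re * Real.sin α := by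
    apply norm_le_of_forall_unit
    intro ζ hζ
    have h1 := hsec' (x + ζ • y)
    have h2 := hsec' (x + conj ζ • y)
    rw [hform ζ hζ] at h1
    rw [hform (conj ζ) (by rwa [Complex.norm_conj])] at h2
    have h3 := mul_le_mul_of_nonneg_right (le_abs_self (2 * p + conj ζ + ζ * q).im) hcos.le
    have h4 := mul_le_mul_of_nonneg_right
      (neg_abs_le (2 * p + conj (conj ζ) + conj ζ * q).im) hcos.le
    simp only [Complex.add_re, Complex.add_im, Complex.mul_re, Complex.mul_im, Complex.conj_re,
      Complex.conj_im, Complex.re_ofNat, Complex.im_ofNat] at h1 h2 h3 h4 ⊢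
    nlinarith
  have hh2 := pow_le_pow_left₀ (norm_nonneg _) hh 2
  have hsq : Real.sin α ^ 2 = sPar α := rfl
  have hcq : Real.cos α ^ 2 = 1 - sPar α := by rw [Real.cos_sq', hsq]
  rw [Complex.sq_norm, Complex.normSq_mk] at hh2
  refine ⟨?_, ?_, ?_⟩
  · have := (norm_nonneg _).trans hh
    by_contra hneg
    nlinarith
  · have e1 : (2 * p.re * Real.sin α) ^ 2 = 4 * sPar α * p.re ^ 2 := by rw [← hsq]; ring
    have e2 : Real.sin α * (1 + q.re) * (Real.sin α * (1 + q.re)) +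
        -(Real.cos α * (1 - q.re)) * -(Real.cos α * (1 - q.re)) =
        (1 - q.re) ^ 2 + 4 * sPar α * q.re := by
      linear_combination (1 + q.re) ^ 2 * hsq + (1 - q.re) ^ 2 * hcq
    rwa [e1, e2] at hh2
  -- Adding the squared bounds at `ζ = i` and `ζ = -i` cancels the cross terms.
  · have hI := hw (x + Complex.I • y)
    have hJ := hw (x + (-Complex.I) • y)
    rw [hform _ (by simp), hnorm _ (by simp)] at hI hJ
    have hI2 := pow_le_pow_left₀ (norm_nonneg _) hI 2
    have hJ2 := pow_le_pow_left₀ (norm_nonneg _) hJ 2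
    rw [Complex.sq_norm, Complex.normSq_apply] at hI2 hJ2
    simp only [Complex.add_re, Complex.add_im, Complex.mul_re, Complex.mul_im, Complex.conj_re,
      Complex.conj_im, Complex.re_ofNat, Complex.im_ofNat, Complex.I_re, Complex.I_im,
      Complex.neg_re, Complex.neg_im] at hI2 hJ2
    nlinarith

theorem sPar_pos {α : ℝ} (hα0 : 0 < α) (hα1 : α < Real.pi / 2) : 0 < sPar α :=
  pow_pos (Real.sin_pos_of_pos_of_lt_pi hα0 (by linarith [Real.pi_pos])) 2

theorem sPar_lt_one {α : ℝ} (hα0 : 0 < α) (hα1 : α < Real.pi / 2) : sPar α < 1 := by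
  have hcos : 0 < Real.cos α := Real.cos_pos_of_mem_Ioo ⟨by linarith, hα1⟩
  have h := Real.sin_sq_add_cos_sq α
  rw [sPar]
  nlinarith

/-- The weights `1 + s` on `h1` and `4s(1 + s)` on `h2` cancel `p1²`; completing the square in `1 -
q1` gives the rest. -/
theorem core_algebra {s p1 p2 q1 q2 W : ℝ} (hs : 0 < s)
    (h1 : (1 - q1) ^ 2 + 4 * s * q1 ≤ 4 * s * p1 ^ 2)
    (h2 : p1 ^ 2 + p2 ^ 2 + ((1 - q1) ^ 2 + q2 ^ 2) / 4 ≤ W * (1 + p2 ^ 2)) :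
    ((1 + s) * (1 - q1) - 2 * s) ^ 2 + 4 * s ^ 2 * p2 ^ 2 + s * (1 + s) * q2 ^ 2 ≤
      4 * s * ((1 + s) * W - 1) * (1 + p2 ^ 2) := by
  have h3 := mul_le_mul_of_nonneg_left h2 (by positivity : 0 ≤ 4 * s * (1 + s))
  have h4 := mul_le_mul_of_nonneg_left h1 (by positivity : 0 ≤ 1 + s)
  nlinarith

theorem one_le_of_core {N : E →L[ℂ] E} {x y : E} {α w : ℝ} (hα0 : 0 < α)
    (hα1 : α < Real.pi / 2) (hx : ‖x‖ = 1) (hy : ‖y‖ = 1)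
    (hxy : N x = y) (hN : ∀ z, inner ℂ y (N z) = inner ℂ x z)
    (hsec : ∀ v, |(inner ℂ v (N v)).im| ≤ (inner ℂ v (N v)).re * Real.tan α)
    (hw : ∀ v, ‖inner ℂ v (N v)‖ ≤ w * ‖v‖ ^ 2) : 1 ≤ (1 + sPar α) * w ^ 2 := by
  obtain ⟨-, h1, h2⟩ := core_inequality hα0 hα1 hx hy hxy hN hsec hw
  have hs := sPar_pos hα0 hα1
  have h3 := core_algebra hs h1 h2
  by_contra! hlt
  have h4 : 0 < 4 * sPar α * (1 - (1 + sPar α) * w ^ 2) * (1 + (inner ℂ x y).im ^ 2) := by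
    have : 0 < 1 - (1 + sPar α) * w ^ 2 := by linarith
    positivity
  have h5 : 0 ≤ ((1 + sPar α) * (1 - (inner ℂ x (N y)).re) - 2 * sPar α) ^ 2 +
    4 * sPar α ^ 2 * (inner ℂ x y).im ^ 2 +
    sPar α * (1 + sPar α) * (inner ℂ x (N y)).im ^ 2 := by positivity
  linarith

/-- In the equality case the Gram data of `x`, `y = N x` and `N y` are determined by `α`. -/
theorem gram_of_core_eq {N : E →L[ℂ] E} {x y : E} {α w : ℝ} (hα0 : 0 < α)
    (hα1 : α < Real.pi / 2) (hx : ‖x‖ = 1) (hy : ‖y‖ = 1)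
    (hxy : N x = y) (hN : ∀ z, inner ℂ y (N z) = inner ℂ x z)
    (hsec : ∀ v, |(inner ℂ v (N v)).im| ≤ (inner ℂ v (N v)).re * Real.tan α)
    (hw : ∀ v, ‖inner ℂ v (N v)‖ ≤ w * ‖v‖ ^ 2) (hweq : (1 + sPar α) * w ^ 2 = 1) :
    inner ℂ x y = ((Real.sqrt (1 + sPar α - sPar α ^ 2) / (1 + sPar α) : ℝ) : ℂ) ∧
    inner ℂ x (N y) = (((1 - sPar α) / (1 + sPar α) : ℝ) : ℂ) := by
  obtain ⟨h0, h1, h2⟩ := core_inequality hα0 hα1 hx hy hxy hN hsec hw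
  have hs := sPar_pos hα0 hα1
  have h3 := core_algebra hs h1 h2
  rw [hweq] at h3
  set p : ℂ := inner ℂ x y
  set q : ℂ := inner ℂ x (N y)
  set s := sPar α
  have a1 : 0 ≤ ((1 + s) * (1 - q.re) - 2 * s) ^ 2 := sq_nonneg _
  have a2 : 0 ≤ 4 * s ^ 2 * p.im ^ 2 := by positivity
  have a3 : 0 ≤ s * (1 + s) * q.im ^ 2 := by positivity
  have b1 : (1 + s) * (1 - q.re) - 2 * s = 0 := pow_eq_zero_iff two_ne_zero |>.1 (by linarith)
  have b2 : p.im = 0 := by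
    have : 4 * s ^ 2 * p.im ^ 2 = 0 := by linarith
    simpa [hs.ne'] using this
  have b3 : q.im = 0 := by
    have : s * (1 + s) * q.im ^ 2 = 0 := by linarith
    simpa [hs.ne', (by positivity : 1 + s ≠ 0)] using this
  have c1 : q.re = (1 - s) / (1 + s) := by
    field_simp
    linarith
  -- With the other parameters fixed, the radius inequality bounds `p.re ^ 2` from above and the
  -- sector inequality from below, by the same value.
  have c2 : p.re ^ 2 = (1 + s - s ^ 2) / (1 + s) ^ 2 := by
    have hW : w ^ 2 = 1 / (1 + s) := by field_simp; linarith
    rw [b2, b3, c1, hW] at h2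
    rw [c1] at h1
    apply le_antisymm
    · have e : (1 + s - s ^ 2) / (1 + s) ^ 2 = 1 / (1 + s) - (1 - (1 - s) / (1 + s)) ^ 2 / 4 := by
        field_simp
        ring
      rw [e]
      linarith
    · have e : 4 * s * ((1 + s - s ^ 2) / (1 + s) ^ 2) =
          (1 - (1 - s) / (1 + s)) ^ 2 + 4 * s * ((1 - s) / (1 + s)) := by
        field_simp
        ring
      exact le_of_mul_le_mul_left (e.trans_le h1) (by positivity)
  constructor
  · apply Complex.ext
    · rw [Complex.ofReal_re, ← Real.sqrt_sq h0, c2, Real.sqrt_div', Real.sqrt_sq (by positivity)]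
      positivity
    · rw [Complex.ofReal_im, b2]
  · apply Complex.ext
    · rw [Complex.ofReal_re, c1]
    · rw [Complex.ofReal_im, b3]

/-- The first-order condition at a vector where `|⟨N v, v⟩|` attains its bound. -/
theorem re_polar_eq_zero {N : E →L[ℂ] E} {w : ℝ}
    (hw : ∀ v, ‖inner ℂ v (N v)‖ ≤ w * ‖v‖ ^ 2) {v z : E} {m : ℂ}
    (hm : (m * inner ℂ v (N v)).re = ‖m‖ * (w * ‖v‖ ^ 2)) (hvz : inner ℂ v z = 0) :
    (m * (inner ℂ v (N z) + inner ℂ z (N v))).re = 0 := by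
  have h : ∀ t : ℝ, 0 ≤ t * (-(m * (inner ℂ v (N z) + inner ℂ z (N v))).re) +
      t ^ 2 * (‖m‖ * (w * ‖z‖ ^ 2) - (m * inner ℂ z (N z)).re) := by
    intro t
    have h1 : (m * inner ℂ (v + (t : ℂ) • z) (N (v + (t : ℂ) • z))).re ≤
        ‖m‖ * (w * ‖v + (t : ℂ) • z‖ ^ 2) := by
      refine (Complex.re_le_norm _).trans ?_
      rw [norm_mul]
      gcongr
      exact hw _
    have h2 : ‖v + (t : ℂ) • z‖ ^ 2 = ‖v‖ ^ 2 + t ^ 2 * ‖z‖ ^ 2 := by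
      rw [norm_add_sq (𝕜 := ℂ), inner_smul_right, hvz, norm_smul, Complex.norm_real, mul_pow,
        Real.norm_eq_abs, sq_abs]
      simp
    have h3 : m * inner ℂ (v + (t : ℂ) • z) (N (v + (t : ℂ) • z)) = m * inner ℂ v (N v) +
        (t : ℂ) * (m * (inner ℂ v (N z) + inner ℂ z (N v))) +
        ((t ^ 2 : ℝ) : ℂ) * (m * inner ℂ z (N z)) := by
      rw [map_add, map_smul]
      simp only [inner_add_left, inner_add_right, inner_smul_left, inner_smul_right,
        Complex.conj_ofReal]
      push_cast
      ring
    rw [h2, h3, Complex.add_re, Complex.add_re, Complex.re_ofReal_mul, Complex.re_ofReal_mul,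
      hm] at h1
    linarith
  linarith [eq_zero_of_forall_nonneg_add_sq h]

/-- In the equality case `span {x, N x}` reduces `N`. -/
theorem inner_eq_zero_of_core_eq {N : E →L[ℂ] E} {x y : E} {α w : ℝ} (hα0 : 0 < α)
    (hα1 : α < Real.pi / 2) (hx : ‖x‖ = 1) (hy : ‖y‖ = 1)
    (hxy : N x = y) (hN : ∀ z, inner ℂ y (N z) = inner ℂ x z)
    (hsec : ∀ v, |(inner ℂ v (N v)).im| ≤ (inner ℂ v (N v)).re * Real.tan α)
    (hw : ∀ v, ‖inner ℂ v (N v)‖ ≤ w * ‖v‖ ^ 2) (hw0 : 0 ≤ w) (hweq : (1 + sPar α) * w ^ 2 = 1)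
    {z : E} (hxz : inner ℂ x z = 0) (hyz : inner ℂ y z = 0) :
    inner ℂ x (N z) = 0 ∧ inner ℂ z (N y) = 0 := by
  obtain ⟨hp, hq⟩ := gram_of_core_eq hα0 hα1 hx hy hxy hN hsec hw hweq
  have hs := sPar_pos hα0 hα1
  have hs1 := sPar_lt_one hα0 hα1
  set s := sPar α
  set P : ℝ := Real.sqrt (1 + s - s ^ 2) / (1 + s) with hP
  set D : ℝ := s / (1 + s) with hD
  have hP2 : P ^ 2 = (1 + s - s ^ 2) / (1 + s) ^ 2 := by
    rw [hP, div_pow, Real.sq_sqrt (by nlinarith)]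
  have hD2 : (1 - s) / (1 + s) = 1 - 2 * D := by
    rw [hD]
    field_simp
    ring
  have hPD : P ^ 2 + D ^ 2 = w ^ 2 := by
    have hW : w ^ 2 = 1 / (1 + s) := by field_simp; linarith
    rw [hP2, hD, hW]
    field_simp
    ring
  -- Up to sign, the determinant of the linear systems solved at the end; `s < 1` keeps it nonzero.
  have hne : P ^ 2 - D ^ 2 ≠ 0 := by
    have e : P ^ 2 - D ^ 2 = (1 - s) * (1 + 2 * s) / (1 + s) ^ 2 := by
      rw [hP2, hD]
      field_simp
      ring
    have : 0 < 1 - s := by linarith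
    rw [e]
    positivity
  rw [hD2] at hq
  -- At `v = x + εiy` the form is `2(P - εiD)` and `‖v‖² = 2`, so `P² + D² = w²` makes `v` extremal,
  -- with multiplier `m = P + εiD`.
  have test : ∀ (ε : ℝ), ε ^ 2 = 1 → ∀ u : E, inner ℂ x u = 0 → inner ℂ y u = 0 →
      ((⟨P, ε * D⟩ : ℂ) * (inner ℂ x (N u) + (ε * Complex.I) * inner ℂ u (N y))).re = 0 := by
    intro ε hε u hxu hyu
    have hζ : ‖(ε * Complex.I : ℂ)‖ = 1 := by
      have : |ε| = 1 := by rwa [← sq_eq_sq₀ (abs_nonneg _) zero_le_one, sq_abs, one_pow]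
      simp [this]
    have hform := inner_add_smul_apply hy hxy hN hζ
    have hnorm := norm_add_smul_sq_of_unit hx hy hζ
    rw [hp, hq] at hform
    rw [hp] at hnorm
    have hnm : ‖(⟨P, ε * D⟩ : ℂ)‖ = w := by
      rw [← sq_eq_sq₀ (norm_nonneg _) hw0, Complex.sq_norm, Complex.normSq_mk]
      linear_combination hPD + D ^ 2 * hε
    have hpol := re_polar_eq_zero hw (v := x + (ε * Complex.I : ℂ) • y) (z := u)
      (m := ⟨P, ε * D⟩) (by
        rw [hform, hnorm, hnm]
        simp
        linear_combination 2 * hPD + 2 * D ^ 2 * hε)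
      (by rw [inner_add_left, inner_smul_left, hxu, hyu]; simp)
    have e1 : inner ℂ (x + (ε * Complex.I : ℂ) • y) (N u) = inner ℂ x (N u) := by
      rw [inner_add_left, inner_smul_left, hN, hxu]; simp
    have e2 : inner ℂ u (N (x + (ε * Complex.I : ℂ) • y)) =
        (ε * Complex.I) * inner ℂ u (N y) := by
      rw [map_add, map_smul, hxy, inner_add_right, inner_smul_right,
        inner_eq_zero_symm.1 hyu, zero_add]
    rwa [e1, e2] at hpol
  have t1 := test 1 (by norm_num) z hxz hyz
  have t2 := test (-1) (by norm_num) z hxz hyz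
  have t3 := test 1 (by norm_num) (Complex.I • z) (by simp [hxz])
    (by simp [hyz])
  have t4 := test (-1) (by norm_num) (Complex.I • z) (by simp [hxz])
    (by simp [hyz])
  rw [map_smul, inner_smul_right, inner_smul_left] at t3 t4
  set A : ℂ := inner ℂ x (N z)
  set B : ℂ := inner ℂ z (N y)
  simp at t1 t2 t3 t4
  -- The choices `ε = ±1` and directions `z`, `iz` give four real equations, which decouple into two
  -- systems of this shape.
  have solve : ∀ u v : ℝ, P * u = D * v → D * u = P * v → u = 0 ∧ v = 0 := by
    intro u v h1 h2
    constructor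
    · refine (mul_eq_zero.1 (?_ : (P ^ 2 - D ^ 2) * u = 0)).resolve_left hne
      linear_combination P * h1 - D * h2
    · refine (mul_eq_zero.1 (?_ : (P ^ 2 - D ^ 2) * v = 0)).resolve_left hne
      linear_combination D * h1 - P * h2
  obtain ⟨r1, r2⟩ := solve (A.re - B.im) (A.im + B.re) (by linarith) (by linarith)
  obtain ⟨r3, r4⟩ := solve (A.re + B.im) (B.re - A.im) (by linarith) (by linarith)
  constructor <;> apply Complex.ext <;> simp <;> linarith

end Core

/-! ### Numerical range and norm of the matrix `B` -/

section MatrixB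

theorem cPar_sq (α : ℝ) : cPar α ^ 2 = sPar α ^ 2 / (1 + 2 * sPar α) := by
  have := sPar_nonneg α
  rw [cPar, div_pow, Real.sq_sqrt (by positivity)]

theorem cos_thetaPar_pos {α : ℝ} (hα0 : 0 < α) (hα1 : α < Real.pi / 2) :
    0 < Real.cos (thetaPar α) :=
  Real.cos_pos_of_mem_Ioo ⟨by linarith [thetaPar_nonneg α, Real.pi_pos],
    by linarith [thetaPar_le α hα0.le hα1]⟩

theorem cos_thetaPar_sq_eq (α : ℝ) :
    Real.cos (thetaPar α) ^ 2 = Real.cos α ^ 2 + cPar α ^ 2 := by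
  have := sPar_nonneg α
  have hcq : Real.cos α ^ 2 = 1 - sPar α := Real.cos_sq' α
  rw [cos_thetaPar_sq, cPar_sq, hcq]
  field_simp
  ring

theorem opB_apply_zero (α : ℝ) (v : EuclideanSpace ℂ (Fin 2)) :
    opB α v 0 = ((Real.cos (thetaPar α) + cPar α : ℝ) : ℂ) * v 0 + ((Real.sin α : ℝ) : ℂ) * v 1 := by
  simp [opB, Matrix.ofLp_toEuclideanCLM, Matrix.mulVec, dotProduct, Fin.sum_univ_two]

theorem opB_apply_one (α : ℝ) (v : EuclideanSpace ℂ (Fin 2)) :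
    opB α v 1 = ((-Real.sin α : ℝ) : ℂ) * v 0 + ((Real.cos (thetaPar α) - cPar α : ℝ) : ℂ) * v 1 := by
  simp [opB, Matrix.ofLp_toEuclideanCLM, Matrix.mulVec, dotProduct, Fin.sum_univ_two]

theorem euclidean_two_norm_sq (v : EuclideanSpace ℂ (Fin 2)) :
    ‖v‖ ^ 2 = Complex.normSq (v 0) + Complex.normSq (v 1) := by
  rw [EuclideanSpace.norm_sq_eq, Fin.sum_univ_two, Complex.sq_norm, Complex.sq_norm]

/-- In the Bloch coordinates `u`, `t` of a vector, the form of `B` traces a filled ellipse with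
centre `cos θ` and semi-axes `c` and `sin α`. -/
theorem opB_form (α : ℝ) (v : EuclideanSpace ℂ (Fin 2)) :
    ∃ u t : ℝ, u ^ 2 + t ^ 2 ≤ (‖v‖ ^ 2) ^ 2 ∧
      (inner ℂ v (opB α v)).re = Real.cos (thetaPar α) * ‖v‖ ^ 2 + cPar α * u ∧
      (inner ℂ v (opB α v)).im = Real.sin α * t := by
  refine ⟨Complex.normSq (v 0) - Complex.normSq (v 1), 2 * (conj (v 0) * v 1).im, ?_, ?_, ?_⟩
  · rw [euclidean_two_norm_sq]
    simp only [Complex.normSq_apply, Complex.mul_im, Complex.conj_re, Complex.conj_im]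
    nlinarith [sq_nonneg ((v 0).re * (v 1).re + (v 0).im * (v 1).im)]
  · rw [euclidean_two_norm_sq, PiLp.inner_apply, Fin.sum_univ_two, opB_apply_zero, opB_apply_one]
    simp only [RCLike.inner_apply', Complex.normSq_apply, Complex.add_re,
      Complex.mul_re, Complex.mul_im, Complex.add_im, Complex.conj_re, Complex.conj_im,
      Complex.ofReal_re, Complex.ofReal_im]
    ring
  · rw [PiLp.inner_apply, Fin.sum_univ_two, opB_apply_zero, opB_apply_one]
    simp only [RCLike.inner_apply', Complex.add_re,
      Complex.mul_re, Complex.mul_im, Complex.add_im, Complex.conj_re, Complex.conj_im,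
      Complex.ofReal_re, Complex.ofReal_im]
    ring

theorem opB_sector {α : ℝ} (hα0 : 0 < α) (hα1 : α < Real.pi / 2)
    (v : EuclideanSpace ℂ (Fin 2)) :
    |(inner ℂ v (opB α v)).im| ≤ (inner ℂ v (opB α v)).re * Real.tan α := by
  obtain ⟨u, t, hut, hre, him⟩ := opB_form α v
  have hsin : 0 < Real.sin α := Real.sin_pos_of_pos_of_lt_pi hα0 (by linarith [Real.pi_pos])
  have hcos : 0 < Real.cos α := Real.cos_pos_of_mem_Ioo ⟨by linarith, hα1⟩
  rw [hre, him, abs_mul, abs_of_pos hsin, Real.tan_eq_sin_div_cos, mul_div_assoc',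
    le_div_iff₀ hcos]
  -- This is Cauchy–Schwarz. The relation `cos² θ = cos² α + c²` says that the ellipse is tangent to
  -- the sides of the sector.
  have key : |t| * Real.cos α - cPar α * u ≤ Real.cos (thetaPar α) * ‖v‖ ^ 2 := by
    apply le_of_sq_le_sq _ (mul_nonneg (cos_thetaPar_pos hα0 hα1).le (sq_nonneg _))
    rw [mul_pow, cos_thetaPar_sq_eq]
    have h1 : (Real.cos α ^ 2 + cPar α ^ 2) * (u ^ 2 + |t| ^ 2) ≤
        (Real.cos α ^ 2 + cPar α ^ 2) * (‖v‖ ^ 2) ^ 2 := by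
      rw [sq_abs]
      gcongr
    nlinarith [sq_nonneg (Real.cos α * u + cPar α * |t|)]
  have := mul_le_mul_of_nonneg_left key hsin.le
  linarith

theorem opB_norm_inner_le (α : ℝ) (v : EuclideanSpace ℂ (Fin 2)) :
    ‖inner ℂ v (opB α v)‖ ≤ Real.sqrt ((1 + 2 * sPar α) / (1 + sPar α)) * ‖v‖ ^ 2 := by
  obtain ⟨u, t, hut, hre, him⟩ := opB_form α v
  have hs := sPar_nonneg α
  apply le_of_sq_le_sq _ (by positivity)
  rw [mul_pow, Real.sq_sqrt (by positivity), Complex.sq_norm, Complex.normSq_apply, hre, him]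
  set n := ‖v‖ ^ 2
  set C := Real.cos (thetaPar α)
  set c := cPar α
  set s := sPar α
  have hC : C ^ 2 = (1 + s - s ^ 2) / (1 + 2 * s) := cos_thetaPar_sq α
  have hc : c ^ 2 = s ^ 2 / (1 + 2 * s) := cPar_sq α
  have hsin : Real.sin α ^ 2 = s := rfl
  have h1 : s * (u ^ 2 + t ^ 2) ≤ s * n ^ 2 := by gcongr
  have h2 : (C * n + c * u) * (C * n + c * u) + Real.sin α * t * (Real.sin α * t) ≤
      C ^ 2 * n ^ 2 + 2 * (C * n) * (c * u) + c ^ 2 * u ^ 2 + s * (n ^ 2 - u ^ 2) := by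
    rw [← hsin] at h1 ⊢
    nlinarith
  refine h2.trans ?_
  -- Weighted AM-GM, with the weight chosen so that the `u²` terms cancel in `h5`. When `s = 0` the
  -- quotient `(1 + s) / s` is `0` by convention, but then `c = 0` too.
  have h3 : 2 * (C * n) * (c * u) ≤ (s / (1 + s)) * (C * n) ^ 2 + ((1 + s) / s) * (c * u) ^ 2 := by
    rcases hs.eq_or_lt with h0 | h0
    · have : c = 0 := by
        have : c ^ 2 = 0 := by rw [hc, ← h0]; simp
        simpa using this
      rw [this, ← h0]
      simp
    · have e : (s / (1 + s)) * (C * n) ^ 2 + ((1 + s) / s) * (c * u) ^ 2 - 2 * (C * n) * (c * u) =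
          (s * (C * n) - (1 + s) * (c * u)) ^ 2 / (s * (1 + s)) := by
        field_simp
        ring
      have : 0 ≤ (s * (C * n) - (1 + s) * (c * u)) ^ 2 / (s * (1 + s)) := by positivity
      linarith
  have h4 : (s / (1 + s)) * (C * n) ^ 2 + C ^ 2 * n ^ 2 + s * n ^ 2 =
      (1 + 2 * s) / (1 + s) * n ^ 2 := by
    rw [mul_pow, hC]
    field_simp
    ring
  have h5 : ((1 + s) / s) * (c * u) ^ 2 + c ^ 2 * u ^ 2 = s * u ^ 2 := by
    rw [mul_pow, hc]
    rcases hs.eq_or_lt with h0 | h0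
    · simp [← h0]
    · field_simp
      ring
  linarith

/-- An eigenvector of `B* B` for its largest eigenvalue `1 + 2s`. -/
noncomputable def vecB (α : ℝ) : EuclideanSpace ℂ (Fin 2) :=
  !₂[((Real.sin (thetaPar α) ^ 2 + Real.cos (thetaPar α) * cPar α : ℝ) : ℂ),
    ((cPar α * Real.sin α : ℝ) : ℂ)]

theorem vecB_ne_zero {α : ℝ} (hα0 : 0 < α) (hα1 : α < Real.pi / 2) : vecB α ≠ 0 := by
  intro h
  have h1 : vecB α 1 = 0 := by rw [h]; rfl
  have hsin : 0 < Real.sin α := Real.sin_pos_of_pos_of_lt_pi hα0 (by linarith [Real.pi_pos])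
  have hs := sPar_pos hα0 hα1
  have hc : 0 < cPar α := div_pos hs (Real.sqrt_pos.2 (by positivity))
  simp only [vecB, Matrix.cons_val_one, Matrix.cons_val_fin_one, Complex.ofReal_eq_zero] at h1
  exact (mul_pos hc hsin).ne' h1

theorem norm_opB_vecB_sq (α : ℝ) : ‖opB α (vecB α)‖ ^ 2 = (1 + 2 * sPar α) * ‖vecB α‖ ^ 2 := by
  rw [euclidean_two_norm_sq, euclidean_two_norm_sq, opB_apply_zero, opB_apply_one]
  have e0 : vecB α 0 =
    ((Real.sin (thetaPar α) ^ 2 + Real.cos (thetaPar α) * cPar α : ℝ) : ℂ) := rfl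
  have e1 : vecB α 1 = ((cPar α * Real.sin α : ℝ) : ℂ) := rfl
  rw [e0, e1]
  simp only [← Complex.ofReal_mul, ← Complex.ofReal_add, Complex.normSq_ofReal]
  have hs := sPar_nonneg α
  have hS : Real.sin (thetaPar α) ^ 2 = (sPar α + sPar α ^ 2) / (1 + 2 * sPar α) :=
    sin_thetaPar_sq α
  have hC : Real.cos (thetaPar α) ^ 2 = (1 + sPar α - sPar α ^ 2) / (1 + 2 * sPar α) :=
    cos_thetaPar_sq α
  have hc := cPar_sq α
  have hsin : Real.sin α ^ 2 = sPar α := rfl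
  rw [hS]
  set C := Real.cos (thetaPar α)
  set c := cPar α
  set s := sPar α
  set g := Real.sin α
  set S := (s + s ^ 2) / (1 + 2 * s) with hSdef
  have k1 : C ^ 2 + c ^ 2 + s - (1 + 2 * s) = -2 * S := by
    rw [hC, hc, hSdef]
    field_simp
    ring
  -- In view of `k1`, this says that `B*B - (1 + 2s)` is singular.
  have k2 : S ^ 2 = c ^ 2 * (C ^ 2 + s) := by
    rw [hC, hc, hSdef]
    field_simp
    ring
  linear_combination (((S + C * c) ^ 2 + (c * g) ^ 2) * k1 - 2 * (S + C * c) * k2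
    + (2 * c ^ 2 * (S + C * c) + (S + C * c) ^ 2 + (c * g) ^ 2) * hsin)

end MatrixB

/-! ### The inequality between norm and numerical radius -/

section NormInequality

variable {E : Type*} [NormedAddCommGroup E] [InnerProductSpace ℂ E]

theorem normalized_apply (T : E →L[ℂ] E) (v : E) :
    normalized T v = ((‖T‖⁻¹ : ℝ) : ℂ) • T v := rfl

theorem inner_normalized (T : E →L[ℂ] E) (v : E) :
    inner ℂ v (normalized T v) = ((‖T‖⁻¹ : ℝ) : ℂ) * inner ℂ v (T v) := by
  rw [normalized_apply, inner_smul_right]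

theorem norm_normalized {T : E →L[ℂ] E} (hT : T ≠ 0) : ‖normalized T‖ = 1 := by
  rw [normalized, norm_smul, Complex.norm_real, norm_inv, norm_norm,
    inv_mul_cancel₀ (norm_ne_zero_iff.2 hT)]

theorem normalized_sector {T : E →L[ℂ] E} {α : ℝ}
    (h : ∀ v, |(inner ℂ v (T v)).im| ≤ (inner ℂ v (T v)).re * Real.tan α) (v : E) :
    |(inner ℂ v (normalized T v)).im| ≤ (inner ℂ v (normalized T v)).re * Real.tan α := by
  rw [inner_normalized, Complex.im_ofReal_mul, Complex.re_ofReal_mul, abs_mul,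
    abs_of_nonneg (by positivity), mul_assoc]
  exact mul_le_mul_of_nonneg_left (h v) (by positivity)

theorem normalized_norm_inner_le {T : E →L[ℂ] E} {w : ℝ}
    (h : ∀ v, ‖inner ℂ v (T v)‖ ≤ w * ‖v‖ ^ 2) (v : E) :
    ‖inner ℂ v (normalized T v)‖ ≤ ‖T‖⁻¹ * w * ‖v‖ ^ 2 := by
  rw [inner_normalized, norm_mul, Complex.norm_real, norm_inv, norm_norm, mul_assoc]
  exact mul_le_mul_of_nonneg_left (h v) (by positivity)

theorem norm_normalized_apply {T : E →L[ℂ] E} (hT : T ≠ 0) {x : E} (hTx : ‖T x‖ = ‖T‖) :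
    ‖normalized T x‖ = 1 := by
  rw [normalized_apply, norm_smul, Complex.norm_real, norm_inv, norm_norm, hTx,
    inv_mul_cancel₀ (norm_ne_zero_iff.2 hT)]

theorem inner_normalized_apply_apply {T : E →L[ℂ] E} (hT : T ≠ 0) {x : E} (hx : ‖x‖ = 1)
    (hTx : ‖T x‖ = ‖T‖) (z : E) :
    inner ℂ (normalized T x) (normalized T z) = inner ℂ x z := by
  have h := inner_apply_apply_of_norm_attained (T := normalized T) hx
    (by rw [norm_normalized hT, norm_normalized_apply hT hTx]) z
  simpa [norm_normalized hT] using h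

theorem norm_le_of_norm_attained {T : E →L[ℂ] E} {α w : ℝ} (hα0 : 0 < α)
    (hα1 : α < Real.pi / 2) {x : E} (hx : ‖x‖ = 1) (hTx : ‖T x‖ = ‖T‖)
    (hsec : ∀ v, |(inner ℂ v (T v)).im| ≤ (inner ℂ v (T v)).re * Real.tan α)
    (hw : ∀ v, ‖inner ℂ v (T v)‖ ≤ w * ‖v‖ ^ 2) (hw0 : 0 ≤ w) :
    ‖T‖ ≤ Real.sqrt (1 + sPar α) * w := by
  by_cases hT : T = 0
  · rw [hT, norm_zero]
    positivity
  have hn : 0 < ‖T‖ := norm_pos_iff.2 hT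
  have hs := sPar_nonneg α
  have h := one_le_of_core hα0 hα1 hx (norm_normalized_apply hT hTx) rfl
    (inner_normalized_apply_apply hT hx hTx) (normalized_sector hsec)
    (normalized_norm_inner_le hw)
  apply le_of_sq_le_sq _ (by positivity)
  rw [mul_pow, Real.sq_sqrt (by positivity)]
  rw [mul_pow, inv_pow] at h
  field_simp at h
  linarith

theorem exists_norm_attained [FiniteDimensional ℂ E] [Nontrivial E] (T : E →L[ℂ] E) :
    ∃ x : E, ‖x‖ = 1 ∧ ‖T x‖ = ‖T‖ := by
  have : ProperSpace E := FiniteDimensional.proper ℂ E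
  obtain ⟨x0, hx0⟩ := exists_norm_eq E zero_le_one
  obtain ⟨x, hx, hmax⟩ := (isCompact_sphere (0 : E) 1).exists_isMaxOn ⟨x0, by simpa using hx0⟩
    (f := fun x => ‖T x‖) (by fun_prop)
  have hx1 : ‖x‖ = 1 := by simpa using hx
  refine ⟨x, hx1, le_antisymm (by simpa [hx1] using T.le_opNorm x) ?_⟩
  refine T.opNorm_le_of_unit_norm (norm_nonneg _) fun u hu => ?_
  exact hmax (by simpa using hu)

/-- `T` need not attain its norm, but its compression to `span {v, T v}` does. The compression keeps
the sector and radius bounds and still sends `v` to `T v`. -/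
theorem norm_le_sqrt_mul_numRadius {T : E →L[ℂ] E} {α : ℝ} (hα0 : 0 < α)
    (hα1 : α < Real.pi / 2)
    (hsec : ∀ v, |(inner ℂ v (T v)).im| ≤ (inner ℂ v (T v)).re * Real.tan α) :
    ‖T‖ ≤ Real.sqrt (1 + sPar α) * numRadius T := by
  have hw0 := numRadius_nonneg T
  refine T.opNorm_le_bound (by positivity) fun v => ?_
  by_cases hv : v = 0
  · simp [hv]
  set V : Submodule ℂ E := Submodule.span ℂ {v, T v}
  have hfin : FiniteDimensional ℂ V := FiniteDimensional.span_of_finite ℂ (Set.toFinite _)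
  have hvV : v ∈ V := Submodule.subset_span (by simp)
  have hTvV : T v ∈ V := Submodule.subset_span (by simp)
  have : Nontrivial V := ⟨⟨⟨v, hvV⟩, 0, fun h => hv (congrArg Subtype.val h)⟩⟩
  let A : V →L[ℂ] V := V.orthogonalProjectionOnto ∘L T ∘L V.subtypeL
  have hA : ∀ u : V, inner ℂ u (A u) = inner ℂ (u : E) (T u) := fun u => by
    rw [← Submodule.inner_orthogonalProjectionOnto_eq_of_mem_left]
    rfl
  obtain ⟨x, hx, hAx⟩ := exists_norm_attained A
  have key : ‖A‖ ≤ Real.sqrt (1 + sPar α) * numRadius T := by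
    refine norm_le_of_norm_attained hα0 hα1 hx hAx ?_ ?_ hw0
    · intro u
      rw [hA]
      exact hsec u
    · intro u
      rw [hA]
      exact norm_inner_le_numRadius T u
  have hAv : A ⟨v, hvV⟩ = ⟨T v, hTvV⟩ :=
    Submodule.orthogonalProjectionOnto_mem_subspace_eq_self (⟨T v, hTvV⟩ : V)
  have h := A.le_opNorm ⟨v, hvV⟩
  rw [hAv] at h
  exact h.trans (mul_le_mul_of_nonneg_right key (norm_nonneg v))

end NormInequality

/-! ### The value of `τ(α)` -/

section Tau

theorem exists_linearIsometry_euclidean_two {H : Type*} [NormedAddCommGroup H]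
    [InnerProductSpace ℂ H] (hdim : 2 ≤ Module.rank ℂ H) :
    Nonempty (EuclideanSpace ℂ (Fin 2) →ₗᵢ[ℂ] H) := by
  obtain ⟨t, ht, hli⟩ := (le_rank_iff_exists_linearIndependent_finset (K := ℂ) (V := H) (n := 2)).1
    (by exact_mod_cast hdim)
  have hli' : LinearIndependent ℂ fun i : Fin 2 => ((t.equivFinOfCardEq ht).symm i : H) :=
    hli.comp _ (t.equivFinOfCardEq ht).symm.injective
  have hon := InnerProductSpace.gramSchmidtNormed_orthonormal hli'
  let b := EuclideanSpace.basisFun (Fin 2) ℂ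
  refine ⟨LinearMap.isometryOfOrthonormal (b.toBasis.constr ℂ
    (InnerProductSpace.gramSchmidtNormed ℂ
      fun i : Fin 2 => ((t.equivFinOfCardEq ht).symm i : H))) (v := b.toBasis) (by simp) ?_⟩
  convert hon using 1
  funext i
  simp only [Function.comp_apply, Module.Basis.constr_basis]

/-- The supremum is reached by `J B J*` for an isometry `J` of `ℂ²` into `H`: its form at `v` is
that of `B` at `J* v`, and `‖J* v‖ ≤ ‖v‖`. -/
theorem tauConst_eq {H : Type*} [NormedAddCommGroup H] [InnerProductSpace ℂ H] [CompleteSpace H]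
    (hdim : 2 ≤ Module.rank ℂ H) {α : ℝ} (hα0 : 0 < α) (hα1 : α < Real.pi / 2) :
    tauConst H α = Real.sqrt (1 + sPar α) := by
  have hs := sPar_pos hα0 hα1
  obtain ⟨J⟩ := exists_linearIsometry_euclidean_two hdim
  set J' := J.toContinuousLinearMap
  let T : H →L[ℂ] H := J' ∘L opB α ∘L ContinuousLinearMap.adjoint J'
  have hform : ∀ v, inner ℂ v (T v) =
      inner ℂ (ContinuousLinearMap.adjoint J' v) (opB α (ContinuousLinearMap.adjoint J' v)) := by
    intro v
    rw [ContinuousLinearMap.adjoint_inner_left]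
    rfl
  have hadj : ∀ u, ContinuousLinearMap.adjoint J' (J u) = u := by
    intro u
    refine ext_inner_right ℂ fun z => ?_
    rw [ContinuousLinearMap.adjoint_inner_left]
    exact J.inner_map_map u z
  have hadjn : ∀ v, ‖ContinuousLinearMap.adjoint J' v‖ ≤ ‖v‖ := by
    intro v
    have h := (ContinuousLinearMap.adjoint J').le_opNorm v
    rw [LinearIsometryEquiv.norm_map] at h
    exact h.trans (mul_le_of_le_one_left (norm_nonneg v) J.norm_toContinuousLinearMap_le)
  have hsec : ∀ v, |(inner ℂ v (T v)).im| ≤ (inner ℂ v (T v)).re * Real.tan α := by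
    intro v
    rw [hform]
    exact opB_sector hα0 hα1 _
  have hrad : numRadius T ≤ Real.sqrt ((1 + 2 * sPar α) / (1 + sPar α)) := by
    apply numRadius_le (Real.sqrt_nonneg _)
    intro v
    rw [hform]
    refine (opB_norm_inner_le α _).trans ?_
    gcongr
    exact hadjn v
  have hnorm : Real.sqrt (1 + 2 * sPar α) ≤ ‖T‖ := by
    have hv : 0 < ‖vecB α‖ := norm_pos_iff.2 (vecB_ne_zero hα0 hα1)
    have h := T.le_opNorm (J (vecB α))
    have e : T (J (vecB α)) = J (opB α (vecB α)) := by
      change J (opB α (ContinuousLinearMap.adjoint J' (J (vecB α)))) = _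
      rw [hadj]
    rw [e, J.norm_map, J.norm_map] at h
    have h2 : Real.sqrt (1 + 2 * sPar α) * ‖vecB α‖ ≤ ‖opB α (vecB α)‖ := by
      apply le_of_sq_le_sq _ (norm_nonneg _)
      rw [norm_opB_vecB_sq, mul_pow, Real.sq_sqrt (by positivity)]
    exact le_of_mul_le_mul_right (h2.trans h) hv
  have hnpos : 0 < ‖T‖ := lt_of_lt_of_le (Real.sqrt_pos.2 (by positivity)) hnorm
  have hupper : ∀ r ∈ {r | ∃ T : H →L[ℂ] H, T ≠ 0 ∧ numRange T ⊆ sector α ∧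
      r = ‖T‖ / numRadius T}, r ≤ Real.sqrt (1 + sPar α) := by
    rintro r ⟨A, -, hA, rfl⟩
    exact div_le_of_le_mul₀ (numRadius_nonneg A) (Real.sqrt_nonneg _)
      (norm_le_sqrt_mul_numRadius hα0 hα1 (numRange_subset_sector_iff.1 hA))
  have hT : T ≠ 0 := norm_pos_iff.1 hnpos
  apply le_antisymm
  · exact Real.sSup_le hupper (Real.sqrt_nonneg _)
  · refine le_trans ?_ (le_csSup ⟨_, hupper⟩
      ⟨T, hT, numRange_subset_sector_iff.2 hsec, rfl⟩)
    have hpos : 0 < numRadius T := by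
      refine (numRadius_nonneg T).lt_of_ne fun h0 => ?_
      have h := norm_le_sqrt_mul_numRadius hα0 hα1 hsec
      rw [← h0, mul_zero] at h
      linarith
    rw [le_div_iff₀ hpos]
    calc Real.sqrt (1 + sPar α) * numRadius T
        ≤ Real.sqrt (1 + sPar α) * Real.sqrt ((1 + 2 * sPar α) / (1 + sPar α)) := by gcongr
      _ = Real.sqrt (1 + 2 * sPar α) := by
        rw [← Real.sqrt_mul (by positivity)]
        congr 1
        field_simp
      _ ≤ ‖T‖ := hnorm

end Tau

/-! ### Unitary similarity from Gram data -/

section Similarity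

variable {E F : Type*} [NormedAddCommGroup E] [InnerProductSpace ℂ E]
  [NormedAddCommGroup F] [InnerProductSpace ℂ F]

theorem linearIndependent_pair_of_norm_inner_lt_one {x y : E} (hx : ‖x‖ = 1) (hy : ‖y‖ = 1)
    (hxy : ‖inner ℂ x y‖ < 1) : LinearIndependent ℂ ![x, y] := by
  rw [LinearIndependent.pair_iff]
  intro a b hab
  have hxx : inner ℂ x x = (1 : ℂ) := by simp [inner_self_eq_norm_sq_to_K, hx]
  have hyy : inner ℂ y y = (1 : ℂ) := by simp [inner_self_eq_norm_sq_to_K, hy]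
  have h1 : inner ℂ x (a • x + b • y) = 0 := by rw [hab, inner_zero_right]
  have h2 : inner ℂ y (a • x + b • y) = 0 := by rw [hab, inner_zero_right]
  rw [inner_add_right, inner_smul_right, inner_smul_right, hxx, mul_one] at h1
  rw [inner_add_right, inner_smul_right, inner_smul_right, hyy, mul_one, ← inner_conj_symm] at h2
  have h3 : b * (1 - ((‖inner ℂ x y‖ ^ 2 : ℝ) : ℂ)) = 0 := by
    rw [Complex.ofReal_pow, ← Complex.conj_mul']
    linear_combination h2 - conj (inner ℂ x y) * h1
  have h4 : (1 - ((‖inner ℂ x y‖ ^ 2 : ℝ) : ℂ)) ≠ 0 := by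
    have : 0 < 1 - ‖inner ℂ x y‖ ^ 2 := by nlinarith [norm_nonneg (inner ℂ x y)]
    exact_mod_cast this.ne'
  have hb := (mul_eq_zero.1 h3).resolve_right h4
  refine ⟨?_, hb⟩
  simpa [hb] using h1

/-- Two operators with cyclic vectors of degree two and equal Gram data are unitarily similar. -/
theorem unitarilySimilar_of_gram {A : E →L[ℂ] E} {A' : F →L[ℂ] F} {x : E} {x' : F}
    (hli : LinearIndependent ℂ ![x, A x]) (hsp : ⊤ ≤ Submodule.span ℂ (Set.range ![x, A x]))
    (hli' : LinearIndependent ℂ ![x', A' x'])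
    (hsp' : ⊤ ≤ Submodule.span ℂ (Set.range ![x', A' x']))
    (h00 : inner ℂ x x = inner ℂ x' x') (h01 : inner ℂ x (A x) = inner ℂ x' (A' x'))
    (h11 : inner ℂ (A x) (A x) = inner ℂ (A' x') (A' x'))
    (h02 : inner ℂ x (A (A x)) = inner ℂ x' (A' (A' x')))
    (h12 : inner ℂ (A x) (A (A x)) = inner ℂ (A' x') (A' (A' x'))) :
    UnitarilySimilar A A' := by
  let b := Module.Basis.mk hli hsp
  let b' := Module.Basis.mk hli' hsp'
  let L : E ≃ₗ[ℂ] F := b.equiv b' (Equiv.refl _)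
  have hL0 : L x = x' := by
    have h := b.equiv_apply 0 b' (Equiv.refl _)
    simpa [b, b'] using h
  have hL1 : L (A x) = A' x' := by
    have h := b.equiv_apply 1 b' (Equiv.refl _)
    simpa [b, b'] using h
  have hspan : ∀ v : E, ∃ a c : ℂ, a • x + c • A x = v := fun v => by
    have h := hsp (Submodule.mem_top (x := v))
    rwa [Matrix.range_cons, Matrix.range_cons, Matrix.range_empty, Set.union_empty,
      Set.singleton_union, Submodule.mem_span_pair] at h
  have h10 : inner ℂ (A x) x = inner ℂ (A' x') x' := by
    rw [← inner_conj_symm, h01, inner_conj_symm]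
  have hinner : ∀ u v : E, inner ℂ (L u) (L v) = inner ℂ u v := by
    intro u v
    obtain ⟨a, c, rfl⟩ := hspan u
    obtain ⟨a', c', rfl⟩ := hspan v
    simp only [map_add, map_smul, hL0, hL1, inner_add_left, inner_add_right, inner_smul_left,
      inner_smul_right, h00, h01, h10, h11]
  -- Since `x` and `A x` span, `A (A x)` is determined by its inner products with them.
  have hL2 : L (A (A x)) = A' (A' x') := by
    refine ext_inner_left ℂ fun z => ?_
    obtain ⟨u, rfl⟩ := L.surjective z
    obtain ⟨a, c, rfl⟩ := hspan u
    rw [hinner, map_add, map_smul, map_smul, hL0, hL1]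
    simp only [inner_add_left, inner_smul_left, h02, h12]
  refine ⟨L.isometryOfInner hinner, fun v => ?_⟩
  obtain ⟨a, c, rfl⟩ := hspan v
  simp only [LinearEquiv.coe_isometryOfInner, map_add, map_smul, hL0, hL1, hL2]

end Similarity

/-! ### `B/‖B‖` as the model of the equality case -/

section NormalizedB

/-- The upper bound for `‖B‖` needs no eigenvalue computation: it is the general norm inequality
combined with the radius bound for `B`. -/
theorem exists_opB_norm_attained {α : ℝ} (hα0 : 0 < α) (hα1 : α < Real.pi / 2) :
    ‖opB α‖ = Real.sqrt (1 + 2 * sPar α) ∧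
      ∃ x, ‖x‖ = 1 ∧ ‖opB α x‖ = ‖opB α‖ := by
  have hs := sPar_pos hα0 hα1
  have hv : 0 < ‖vecB α‖ := norm_pos_iff.2 (vecB_ne_zero hα0 hα1)
  have hBv : ‖opB α (vecB α)‖ = Real.sqrt (1 + 2 * sPar α) * ‖vecB α‖ := by
    rw [← sq_eq_sq₀ (norm_nonneg _) (by positivity), norm_opB_vecB_sq, mul_pow,
      Real.sq_sqrt (by positivity)]
  have hnorm : ‖opB α‖ = Real.sqrt (1 + 2 * sPar α) := by
    apply le_antisymm
    · calc ‖opB α‖ ≤ Real.sqrt (1 + sPar α) * numRadius (opB α) :=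
            norm_le_sqrt_mul_numRadius hα0 hα1 (opB_sector hα0 hα1)
        _ ≤ Real.sqrt (1 + sPar α) * Real.sqrt ((1 + 2 * sPar α) / (1 + sPar α)) := by
            gcongr
            exact numRadius_le (Real.sqrt_nonneg _) (opB_norm_inner_le α)
        _ = Real.sqrt (1 + 2 * sPar α) := by
            rw [← Real.sqrt_mul (by positivity)]
            congr 1
            field_simp
    · exact le_of_mul_le_mul_right (hBv.symm.trans_le ((opB α).le_opNorm _)) hv
  refine ⟨hnorm, ((‖vecB α‖⁻¹ : ℝ) : ℂ) • vecB α, ?_, ?_⟩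
  · rw [norm_smul, Complex.norm_real, norm_inv, norm_norm, inv_mul_cancel₀ hv.ne']
  · rw [map_smul, norm_smul, Complex.norm_real, norm_inv, norm_norm, hBv, hnorm]
    field_simp

theorem opB_ne_zero {α : ℝ} (hα0 : 0 < α) (hα1 : α < Real.pi / 2) : opB α ≠ 0 := by
  have hs := sPar_pos hα0 hα1
  rw [← norm_pos_iff, (exists_opB_norm_attained hα0 hα1).1]
  positivity

theorem normalized_opB_norm_inner_le {α : ℝ} (hα0 : 0 < α) (hα1 : α < Real.pi / 2)
    (v : EuclideanSpace ℂ (Fin 2)) :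
    ‖inner ℂ v (normalized (opB α) v)‖ ≤ 1 / Real.sqrt (1 + sPar α) * ‖v‖ ^ 2 := by
  have hs := sPar_pos hα0 hα1
  refine (normalized_norm_inner_le (opB_norm_inner_le α) v).trans_eq ?_
  rw [(exists_opB_norm_attained hα0 hα1).1, Real.sqrt_div (by positivity)]
  have : Real.sqrt (1 + 2 * sPar α) ≠ 0 := by positivity
  field_simp

theorem gram_value_lt_one {s : ℝ} (hs : 0 < s) : Real.sqrt (1 + s - s ^ 2) / (1 + s) < 1 := by
  rw [div_lt_one (by positivity), Real.sqrt_lt' (by positivity)]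
  nlinarith

theorem unitarilySimilar_normalized_opB {E : Type*} [NormedAddCommGroup E]
    [InnerProductSpace ℂ E] {N : E →L[ℂ] E} {x : E} {α w : ℝ} (hα0 : 0 < α)
    (hα1 : α < Real.pi / 2) (hx : ‖x‖ = 1) (hNx : ‖N x‖ = 1)
    (hN : ∀ z, inner ℂ (N x) (N z) = inner ℂ x z)
    (hsp : ∀ v, v ∈ Submodule.span ℂ {x, N x})
    (hsec : ∀ v, |(inner ℂ v (N v)).im| ≤ (inner ℂ v (N v)).re * Real.tan α)
    (hw : ∀ v, ‖inner ℂ v (N v)‖ ≤ w * ‖v‖ ^ 2) (hweq : (1 + sPar α) * w ^ 2 = 1) :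
    UnitarilySimilar N (normalized (opB α)) := by
  have hs := sPar_pos hα0 hα1
  have hB := opB_ne_zero hα0 hα1
  obtain ⟨-, u, hu, hBu⟩ := exists_opB_norm_attained hα0 hα1
  have hNu := norm_normalized_apply hB hBu
  have hBN := inner_normalized_apply_apply hB hu hBu
  obtain ⟨g1, g2⟩ := gram_of_core_eq hα0 hα1 hx hNx rfl hN hsec hw hweq
  -- `B/‖B‖` meets the same equality hypotheses at its own norm-attaining vector, so its Gram data
  -- agree with those of `N` without being computed.
  obtain ⟨k1, k2⟩ := gram_of_core_eq hα0 hα1 hu hNu rfl hBN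
    (normalized_sector (opB_sector hα0 hα1)) (normalized_opB_norm_inner_le hα0 hα1) (by
      rw [div_pow, Real.sq_sqrt (by positivity)]
      field_simp)
  have hlt : ‖((Real.sqrt (1 + sPar α - sPar α ^ 2) / (1 + sPar α) : ℝ) : ℂ)‖ < 1 := by
    rw [Complex.norm_real, Real.norm_of_nonneg (by positivity)]
    exact gram_value_lt_one hs
  have hli := linearIndependent_pair_of_norm_inner_lt_one hx hNx (by rwa [g1])
  have hli' := linearIndependent_pair_of_norm_inner_lt_one hu hNu (by rwa [k1])
  refine unitarilySimilar_of_gram hli ?_ hli' ?_ ?_ ?_ ?_ ?_ ?_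
  · intro v _
    rw [Matrix.range_cons, Matrix.range_cons, Matrix.range_empty, Set.union_empty,
      Set.singleton_union]
    exact hsp v
  · rw [hli'.span_eq_top_of_card_eq_finrank' (by simp)]
  · simp [inner_self_eq_norm_sq_to_K, hx, hu]
  · rw [g1, k1]
  · simp [inner_self_eq_norm_sq_to_K, hNx, hNu]
  · rw [g2, k2]
  · rw [hN, hBN, g1, k1]

end NormalizedB

/-! ### Forms of direct sums -/

section DirectSum

variable {E : Type*} [NormedAddCommGroup E] [InnerProductSpace ℂ E]

theorem inner_of_hasDirectSumForm {N : E →L[ℂ] E} {V : Submodule ℂ E} {T₁ : V →L[ℂ] V}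
    {T₂ : Vᗮ →L[ℂ] Vᗮ} (h : HasDirectSumForm N V T₁ T₂) (v : V) (w : Vᗮ) :
    inner ℂ ((v : E) + w) (N (v + w)) = inner ℂ v (T₁ v) + inner ℂ w (T₂ w) := by
  rw [h, inner_add_left, inner_add_right, inner_add_right,
    Submodule.inner_right_of_mem_orthogonal v.2 (T₂ w).2,
    Submodule.inner_left_of_mem_orthogonal (T₁ v).2 w.2, add_zero, zero_add]
  rfl

theorem norm_add_sq_of_mem_orthogonal {V : Submodule ℂ E} (v : V) (w : Vᗮ) :
    ‖(v : E) + w‖ ^ 2 = ‖v‖ ^ 2 + ‖w‖ ^ 2 := by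
  rw [norm_add_sq (𝕜 := ℂ), Submodule.inner_right_of_mem_orthogonal v.2 w.2]
  simp

theorem UnitarilySimilar.inner_apply {F : Type*} [NormedAddCommGroup F] [InnerProductSpace ℂ F]
    {A : E →L[ℂ] E} {A' : F →L[ℂ] F} (h : UnitarilySimilar A A') (v : E) :
    ∃ u : F, ‖u‖ = ‖v‖ ∧ inner ℂ v (A v) = inner ℂ u (A' u) := by
  obtain ⟨U, hU⟩ := h
  exact ⟨U v, U.norm_map v, by rw [← hU, U.inner_map_map]⟩

end DirectSum

/-! ### The characterization of extremal operators -/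

theorem theorem3p4 {H : Type*} [NormedAddCommGroup H] [InnerProductSpace ℂ H] [CompleteSpace H]
    (hdim : 3 ≤ Module.rank ℂ H)
    (α : ℝ) (hα0 : 0 < α) (hα1 : α < Real.pi / 2)
    (T : H →L[ℂ] H) (hT : T ≠ 0)
    (x : H) (hx : ‖x‖ = 1) (hTx : ‖T x‖ = ‖T‖) :
    (numRange T ⊆ sector α ∧ ‖T‖ / numRadius T = tauConst H α) ↔
      ∃ (T₁ : Submodule.span ℂ {x, T x} →L[ℂ] Submodule.span ℂ {x, T x})
        (T₂ : (Submodule.span ℂ {x, T x})ᗮ →L[ℂ] (Submodule.span ℂ {x, T x})ᗮ),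
        HasDirectSumForm (normalized T) (Submodule.span ℂ {x, T x}) T₁ T₂ ∧
        UnitarilySimilar T₁ (normalized (opB α)) ∧
        numRange T₂ ⊆ sector α ∧
        numRadius T₂ ≤ 1 / tauConst H α := by
  have hs := sPar_pos hα0 hα1
  have hsqrt : 0 < Real.sqrt (1 + sPar α) := Real.sqrt_pos.2 (by positivity)
  have hn : 0 < ‖T‖ := norm_pos_iff.2 hT
  rw [tauConst_eq (le_trans (by norm_num) hdim) hα0 hα1, numRange_subset_sector_iff]
  set V : Submodule ℂ H := Submodule.span ℂ {x, T x}
  have : FiniteDimensional ℂ V := FiniteDimensional.span_of_finite ℂ (Set.toFinite _)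
  have hxV : x ∈ V := Submodule.subset_span (by simp)
  have hyV : normalized T x ∈ V := V.smul_mem _ (Submodule.subset_span (by simp))
  have hyn := norm_normalized_apply hT hTx
  have hN := inner_normalized_apply_apply hT hx hTx
  have hTN : ∀ v, T v = (‖T‖ : ℂ) • normalized T v := fun v => by
    rw [normalized_apply, smul_smul, ← Complex.ofReal_mul, mul_inv_cancel₀ hn.ne',
      Complex.ofReal_one, one_smul]
  have hVpair : ∀ v ∈ V, ∃ a b : ℂ, a • x + b • normalized T x = v := by
    intro v hv
    obtain ⟨a, b, rfl⟩ := Submodule.mem_span_pair.1 hv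
    exact ⟨a, b * ‖T‖, by rw [hTN x, smul_smul]⟩
  constructor
  · rintro ⟨hsec, hrad⟩
    have hsecN := normalized_sector hsec
    have hwN := normalized_norm_inner_le (norm_inner_le_numRadius T)
    -- A zero radius would make the quotient `0` by convention, contradicting `√(1 + s) > 0`.
    have hr0 : numRadius T ≠ 0 := by
      intro h0
      rw [h0, div_zero] at hrad
      exact hsqrt.ne hrad
    have hwval : ‖T‖⁻¹ * numRadius T = 1 / Real.sqrt (1 + sPar α) := by
      rw [← hrad]
      field_simp
    rw [hwval] at hwN
    have hweq : (1 + sPar α) * (1 / Real.sqrt (1 + sPar α)) ^ 2 = 1 := by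
      rw [div_pow, Real.sq_sqrt (by positivity)]
      field_simp
    have hred : ∀ z ∈ Vᗮ, inner ℂ x (normalized T z) = 0 ∧
        inner ℂ z (normalized T (normalized T x)) = 0 := fun z hz =>
      inner_eq_zero_of_core_eq hα0 hα1 hx hyn rfl hN hsecN hwN (by positivity) hweq
        (Submodule.inner_right_of_mem_orthogonal hxV hz)
        (Submodule.inner_right_of_mem_orthogonal hyV hz)
    -- `V` is finite-dimensional, hence equal to its double orthogonal complement.
    have hNyV : normalized T (normalized T x) ∈ V := by
      rw [← Submodule.orthogonal_orthogonal V, Submodule.mem_orthogonal]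
      exact fun z hz => (hred z hz).2
    have hNV : ∀ v : V, normalized T v ∈ V := by
      rintro ⟨v, hv⟩
      obtain ⟨a, b, rfl⟩ := hVpair v hv
      rw [map_add, map_smul, map_smul]
      exact V.add_mem (V.smul_mem _ hyV) (V.smul_mem _ hNyV)
    have hNVperp : ∀ z : Vᗮ, normalized T z ∈ Vᗮ := by
      rintro ⟨z, hz⟩
      rw [Submodule.mem_orthogonal]
      intro u hu
      obtain ⟨a, b, rfl⟩ := hVpair u hu
      rw [inner_add_left, inner_smul_left, inner_smul_left, (hred z hz).1, hN,
        Submodule.inner_right_of_mem_orthogonal hxV hz]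
      simp
    refine ⟨(normalized T ∘L V.subtypeL).codRestrict V hNV,
      (normalized T ∘L Vᗮ.subtypeL).codRestrict Vᗮ hNVperp, ?_, ?_, ?_, ?_⟩
    · intro v w
      rw [map_add]
      rfl
    · refine unitarilySimilar_normalized_opB (x := ⟨x, hxV⟩) hα0 hα1 hx hyn (fun z => hN z) ?_
        (fun v => hsecN v) (fun v => hwN v) hweq
      rintro ⟨v, hv⟩
      obtain ⟨a, b, rfl⟩ := hVpair v hv
      exact Submodule.mem_span_pair.2 ⟨a, b, rfl⟩
    · rw [numRange_subset_sector_iff]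
      exact fun v => hsecN v
    · exact numRadius_le (by positivity) fun v => hwN v
  · rintro ⟨T₁, T₂, hsum, hsim, hsec₂, hrad₂⟩
    rw [numRange_subset_sector_iff] at hsec₂
    have hdec : ∀ u : H, ∃ (v : V) (w : Vᗮ), (v : H) + w = u := fun u =>
      ⟨⟨V.starProjection u, by simp⟩, ⟨u - V.starProjection u,
        V.sub_starProjection_mem_orthogonal u⟩, by simp⟩
    -- The form at `v + w` is the sum of a value of the form of `B/‖B‖` and one of `T₂`, and the
    -- sector is closed under addition.
    have hsecN : ∀ u, |(inner ℂ u (normalized T u)).im| ≤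
        (inner ℂ u (normalized T u)).re * Real.tan α := by
      intro u
      obtain ⟨v, w, rfl⟩ := hdec u
      rw [inner_of_hasDirectSumForm hsum]
      obtain ⟨b, -, hb⟩ := hsim.inner_apply v
      rw [hb, Complex.add_im, Complex.add_re, add_mul]
      exact (abs_add_le _ _).trans
        (add_le_add (normalized_sector (opB_sector hα0 hα1) b) (hsec₂ w))
    have hwN : ∀ u, ‖inner ℂ u (normalized T u)‖ ≤ 1 / Real.sqrt (1 + sPar α) * ‖u‖ ^ 2 := by
      intro u
      obtain ⟨v, w, rfl⟩ := hdec u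
      rw [inner_of_hasDirectSumForm hsum, norm_add_sq_of_mem_orthogonal, mul_add]
      obtain ⟨b, hbn, hb⟩ := hsim.inner_apply v
      rw [hb, ← hbn]
      refine (norm_add_le _ _).trans (add_le_add (normalized_opB_norm_inner_le hα0 hα1 b) ?_)
      exact (norm_inner_le_numRadius T₂ w).trans (by gcongr)
    have hform : ∀ u, inner ℂ u (T u) = (‖T‖ : ℂ) * inner ℂ u (normalized T u) := fun u => by
      rw [hTN, inner_smul_right]
    have hsec : ∀ u, |(inner ℂ u (T u)).im| ≤ (inner ℂ u (T u)).re * Real.tan α := by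
      intro u
      rw [hform, Complex.im_ofReal_mul, Complex.re_ofReal_mul, abs_mul, abs_of_pos hn, mul_assoc]
      exact mul_le_mul_of_nonneg_left (hsecN u) hn.le
    -- The general inequality and the radius bound for the direct sum are opposite, so together they
    -- force equality.
    have hle := norm_le_sqrt_mul_numRadius hα0 hα1 hsec
    have hge : numRadius T ≤ ‖T‖ * (1 / Real.sqrt (1 + sPar α)) := by
      refine numRadius_le (by positivity) fun u => ?_
      rw [hform, norm_mul, Complex.norm_real, norm_norm, mul_assoc]
      exact mul_le_mul_of_nonneg_left (hwN u) hn.le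
    have hpos : 0 < numRadius T := pos_of_mul_pos_right (hn.trans_le hle) hsqrt.le
    refine ⟨hsec, ?_⟩
    rw [div_eq_iff hpos.ne']
    refine le_antisymm hle ?_
    rw [mul_one_div, le_div_iff₀ hsqrt] at hge
    linarith
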